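/- All graphs are finite and simple. For a graph $G$ and $X\subseteq V(G)$, the cut-rank $\rho_G(X)$ is the rank over $\mathrm{GF}(2)$ of the $X\times(V(G)-X)$ matrix whose $(i,j)$-entry is $1$ if $i$ and $j$ are adjacent in $G$ and $0$ otherwise. For disjoint $S,T\subseteq V(G)$, let $\kappa_G(S,T)=\min_{S\subseteq X\subseteq V(G)-T}\rho_G(X)$. For a vertex $v$, let $G\setminus v$ be the graph obtained from $G$ by deleting $v$, and let $G*v$ be the graph obtained from $G$ by toggling the adjacency of every pair of distinct neighbours of $v$. For an edge $uv$, let $G\wedge uv=G*u*v*u$. Let $G$ be a graph and let $Q,R,S,T$ be subsets of $V(G)$ such that $Q\cap R=S\cap T=\emptyset$. Let $\kappa_G(Q,R)=k$, $\kappa_G(S,T)=\ell$, and $F=V(G)-(Q\cup R\cup S\cup T)$. If $|F|\ge(2\ell+1)2^{2k}$, then there exists a vertex $v\in F$ such that at least one of the following holds: (i) $\kappa_{G\setminus v}(Q,R)=k$ and $\kappa_{G\setminus v}(S,T)=\ell$; (ii) $\kappa_{G\wedge uv\setminus v}(Q,R)=k$ and $\kappa_{G\wedge uv\setminus v}(S,T)=\ell$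 for each neighbour $u$ of $v$. -/

import Mathlib

namespace SimpleGraph

variable {V : Type*}

/-- The local complementation `G * v`: for each pair of distinct neighbours `x`, `y` of `v`,
the adjacency of `x` and `y` is toggled. All other adjacencies are kept. -/
def localComplement (G : SimpleGraph V) (v : V) : SimpleGraph V where
  Adj x y := x ≠ y ∧ Xor (G.Adj x y) (G.Adj v x ∧ G.Adj v y)
  symm := ⟨fun x y h => ⟨h.1.symm, by rw [G.adj_comm y x, and_comm (a := G.Adj v y)]; exact h.2⟩⟩
  loopless := ⟨fun _ h => h.1 rfl⟩

/-- The graph `G ∧ uv = G * u * v * u`; it is the result of pivoting `uv` when `uv` is an edge. -/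
def pivot (G : SimpleGraph V) (u v : V) : SimpleGraph V :=
  ((G.localComplement u).localComplement v).localComplement u

/-- The graph `G \ v`, whose vertex set is `V(G) - {v}`. -/
abbrev deleteVertex (G : SimpleGraph V) (v : V) : SimpleGraph ({v}ᶜ : Set V) :=
  G.induce ({v}ᶜ : Set V)

open Classical in
/-- The cut-rank `ρ_G(X)`: the rank over the binary field of the submatrix of the adjacency matrix
with rows indexed by `X` and columns indexed by `V(G) - X`. -/
noncomputable def cutRank [Fintype V] (G : SimpleGraph V) (X : Set V) : ℕ :=
  ((G.adjMatrix (ZMod 2)).submatrix (fun i : X => (i : V)) (fun j : (Xᶜ : Set V) => (j : V))).rank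

/-- The connectivity `κ_G(S, T)`: the minimum of `ρ_G(X)` over all `X` with `S ⊆ X ⊆ V(G) - T`.
For disjoint `S` and `T` (the only case in which it is used) such an `X` exists. -/
noncomputable def cutConnectivity [Fintype V] (G : SimpleGraph V) (S T : Set V) : ℕ :=
  sInf {n : ℕ | ∃ X : Set V, S ⊆ X ∧ X ⊆ Tᶜ ∧ G.cutRank X = n}

open Classical in
/-- The connectivity `κ_{G \ v}(S, T)` for sets `S` and `T` of vertices of `G` that do not
contain `v`; these are regarded as sets of vertices of `G \ v`. -/
noncomputable def cutConnectivityDelete [Fintype V] (G : SimpleGraph V) (v : V) (S T : Set V) : ℕ :=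
  (G.deleteVertex v).cutConnectivity (Subtype.val ⁻¹' S) (Subtype.val ⁻¹' T)

end SimpleGraph

/-! With `A` the adjacency matrix of `G` over GF(2), the vectors `(a, Aa)` form a Lagrangian
subspace `L` of a symplectic space with one plane per vertex, and `ρ X = |X| - dim (L ⊓ supportedOn
X)`. Deleting `v` keeps the members of `L` whose value at `v` is `0` or `(0, 1)`; pivoting on `uv`
first replaces `(0, 1)` by `(1, 0)`. If such a reduction lowers the connectivity of a pair, then `v`
is critical in that direction: there are minimum cuts `X` and `insert v X`, and on either side a
member of `L` with that value at `v`. Orthogonality allows one critical direction per pair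
(`isCritical_unique`). So in a counterexample every `v ∈ F` is critical for `(Q, R)` in a direction
`α v` and for `(S, T)` in a different direction `β v`.

Minimum `(S, T)`-cuts arrange `F` along a chain, which orders it. Minimum `(Q, R)`-cuts yield `2l +
1` disjoint strips with at least `2 ^ (2k)` elements of `F` each. A strip has connectivity at most
`2k`, and a halving argument (`exists_leading`) finds in it a member of `L` that vanishes on `F`
before some `f` and is not orthogonal to `β f` at `f`. As `2l + 1 > 2l`, a nonzero combination of
these can be cleared within `L` beyond both ends of the `(S, T)`-chain (`exists_restrict_mem`),
which leaves its support inside `F`. At its leading element `f`, criticality gives a member of `L`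
on the chain up to `f` with value `β f`. The two supports meet only in `f`, where the pairing is
nonzero, a contradiction. -/

open Module

/-! ### Symplectic linear algebra over GF(2) and connectivity functions. -/

namespace IsotropicSystem

/-- The symplectic form on the plane over the binary field. -/
def wedge (p q : ZMod 2 × ZMod 2) : ZMod 2 := p.1 * q.2 + p.2 * q.1

theorem wedge_self (p : ZMod 2 × ZMod 2) : wedge p p = 0 := by
  revert p; decide

theorem wedge_comm (p q : ZMod 2 × ZMod 2) : wedge p q = wedge q p := by
  simp only [wedge]; ring

@[simp] theorem wedge_zero_left (p : ZMod 2 × ZMod 2) : wedge 0 p = 0 := by simp [wedge]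

@[simp] theorem wedge_zero_right (p : ZMod 2 × ZMod 2) : wedge p 0 = 0 := by simp [wedge]

theorem wedge_add_left (p p' q : ZMod 2 × ZMod 2) :
    wedge (p + p') q = wedge p q + wedge p' q := by
  simp only [wedge, Prod.fst_add, Prod.snd_add]; ring

theorem wedge_smul_left (c : ZMod 2) (p q : ZMod 2 × ZMod 2) :
    wedge (c • p) q = c * wedge p q := by
  simp only [wedge, Prod.smul_fst, Prod.smul_snd, smul_eq_mul]; ring

theorem eq_of_wedge_eq_zero : ∀ {x α : ZMod 2 × ZMod 2},
    wedge x α = 0 → x ≠ 0 → α ≠ 0 → x = α := by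
  decide

theorem wedge_ne_zero : ∀ {x α β : ZMod 2 × ZMod 2},
    wedge x α = 0 → x ≠ 0 → α ≠ 0 → β ≠ 0 → α ≠ β → wedge x β ≠ 0 := by
  decide

variable {V : Type*}

/-- The vectors vanishing outside `X`. -/
def supportedOn (X : Set V) : Submodule (ZMod 2) (V → ZMod 2 × ZMod 2) where
  carrier := {x | ∀ v ∉ X, x v = 0}
  add_mem' hx hy v hv := by simp [hx v hv, hy v hv]
  zero_mem' _ _ := rfl
  smul_mem' c x hx v hv := by simp [hx v hv]

theorem mem_supportedOn {X : Set V} {x : V → ZMod 2 × ZMod 2} :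
    x ∈ supportedOn X ↔ ∀ v ∉ X, x v = 0 := Iff.rfl

theorem supportedOn_mono {X Y : Set V} (h : X ⊆ Y) : supportedOn X ≤ supportedOn Y :=
  fun _ hx v hv => hx v fun hX => hv (h hX)

theorem supportedOn_inf (X Y : Set V) : supportedOn X ⊓ supportedOn Y = supportedOn (X ∩ Y) := by
  ext x
  simp only [Submodule.mem_inf, mem_supportedOn, Set.mem_inter_iff, not_and_or]
  exact ⟨fun h v hv => hv.elim (h.1 v) (h.2 v),
    fun h => ⟨fun v hv => h v (.inl hv), fun v hv => h v (.inr hv)⟩⟩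

open Classical in
/-- Setting all coordinates outside `X` to zero. -/
noncomputable def restrict (X : Set V) :
    (V → ZMod 2 × ZMod 2) →ₗ[ZMod 2] (V → ZMod 2 × ZMod 2) where
  toFun x v := if v ∈ X then x v else 0
  map_add' x y := by ext v <;> by_cases h : v ∈ X <;> simp [h]
  map_smul' c x := by ext v <;> by_cases h : v ∈ X <;> simp [h]

theorem restrict_of_mem {X : Set V} {v : V} (h : v ∈ X) (x : V → ZMod 2 × ZMod 2) :
    restrict X x v = x v := by simp [restrict, h]

theorem restrict_of_notMem {X : Set V} {v : V} (h : v ∉ X) (x : V → ZMod 2 × ZMod 2) :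
    restrict X x v = 0 := by simp [restrict, h]

theorem restrict_mem_supportedOn (X : Set V) (x : V → ZMod 2 × ZMod 2) :
    restrict X x ∈ supportedOn X := fun _ hv => restrict_of_notMem hv x

variable [Fintype V]

/-- The symplectic form on families of vectors of the plane over the binary field. -/
def pairing : LinearMap.BilinForm (ZMod 2) (V → ZMod 2 × ZMod 2) :=
  LinearMap.mk₂ (ZMod 2) (fun x y => ∑ v, wedge (x v) (y v))
    (fun x x' y => by simp [wedge_add_left, Finset.sum_add_distrib])
    (fun c x y => by simp [wedge_smul_left, Finset.mul_sum])
    (fun x y y' => by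
      simp [wedge_comm (x _), wedge_add_left, Finset.sum_add_distrib])
    (fun c x y => by simp [wedge_comm (x _), wedge_smul_left, Finset.mul_sum])

theorem pairing_apply (x y : V → ZMod 2 × ZMod 2) :
    pairing x y = ∑ v, wedge (x v) (y v) := rfl

theorem pairing_comm (x y : V → ZMod 2 × ZMod 2) : pairing x y = pairing y x := by
  simp only [pairing_apply, wedge_comm (x _)]

theorem pairing_self (x : V → ZMod 2 × ZMod 2) : pairing x x = 0 := by
  simp [pairing_apply, wedge_self]

theorem pairing_eq_wedge {x y : V → ZMod 2 × ZMod 2} (v : V)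
    (h : ∀ w ≠ v, x w = 0 ∨ y w = 0) : pairing x y = wedge (x v) (y v) := by
  rw [pairing_apply]
  refine Finset.sum_eq_single v (fun w _ hw => ?_) (fun h => absurd (Finset.mem_univ _) h)
  rcases h w hw with h | h <;> simp [h]

theorem pairing_eq_zero {x y : V → ZMod 2 × ZMod 2}
    (h : ∀ w, x w = 0 ∨ y w = 0) : pairing x y = 0 := by
  rw [pairing_apply]
  refine Finset.sum_eq_zero (fun w _ => ?_)
  rcases h w with h | h <;> simp [h]

theorem pairing_nondegenerate :
    (pairing : LinearMap.BilinForm (ZMod 2) (V → ZMod 2 × ZMod 2)).Nondegenerate := by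
  classical
  have key : ∀ x : V → ZMod 2 × ZMod 2, (∀ y, pairing x y = 0) → x = 0 := by
    intro x hx
    funext v
    have h : ∀ p, wedge (x v) p = 0 := by
      intro p
      have := hx (Pi.single v p)
      rw [pairing_eq_wedge v (fun w hw => .inr (by simp [hw]))] at this
      simpa using this
    have h1 := h (1, 0)
    have h2 := h (0, 1)
    ext
    · simpa [wedge] using h2
    · simpa [wedge] using h1
  exact ⟨key, fun y hy => key y fun x => by rw [pairing_comm]; exact hy x⟩

/-- All pairs of members of `U` are orthogonal. -/
def Isotropic (U : Submodule (ZMod 2) (V → ZMod 2 × ZMod 2)) : Prop :=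
  ∀ x ∈ U, ∀ y ∈ U, pairing x y = 0

theorem Isotropic.finrank_le {U : Submodule (ZMod 2) (V → ZMod 2 × ZMod 2)} (hU : Isotropic U) :
    finrank (ZMod 2) U ≤ Fintype.card V := by
  have h1 : U ≤ pairing.orthogonal U := fun x hx y hy => hU y hy x hx
  have h2 := Submodule.finrank_mono h1
  rw [LinearMap.BilinForm.finrank_orthogonal pairing_nondegenerate] at h2
  have h3 : finrank (ZMod 2) (V → ZMod 2 × ZMod 2) = Fintype.card V * 2 := by
    simp [Module.finrank_pi_fintype]
  omega

theorem Isotropic.finrank_le_ncard {U : Submodule (ZMod 2) (V → ZMod 2 × ZMod 2)}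
    (hU : Isotropic U) {X : Set V} (hX : U ≤ supportedOn X) :
    finrank (ZMod 2) U ≤ X.ncard := by
  classical
  let π := LinearMap.funLeft (ZMod 2) (ZMod 2 × ZMod 2) (Subtype.val : X → V)
  have hinj : Function.Injective (π.domRestrict U) := by
    rw [injective_iff_map_eq_zero]
    intro x hx
    ext1
    funext v
    by_cases hv : v ∈ X
    · exact congrFun hx ⟨v, hv⟩
    · exact hX x.2 v hv
  have hiso : Isotropic (LinearMap.range (π.domRestrict U)) := by
    rintro _ ⟨x, rfl⟩ _ ⟨y, rfl⟩
    rw [← hU x x.2 y y.2, pairing_apply, pairing_apply,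
      ← Finset.sum_subset (Finset.subset_univ X.toFinset)]
    · rw [← Finset.sum_coe_sort X.toFinset]
      refine Fintype.sum_equiv (Equiv.subtypeEquivRight (by simp)) _ _ (fun a => rfl)
    · intro v _ hv
      rw [hX x.2 v (by simpa using hv), wedge_zero_left]
  rw [← LinearMap.finrank_range_of_inj hinj, ← Nat.card_coe_set_eq, Nat.card_eq_fintype_card]
  exact hiso.finrank_le

/-- `ρ` is the connectivity function of the Lagrangian subspace `L`. -/
structure IsCutSystem (L : Submodule (ZMod 2) (V → ZMod 2 × ZMod 2)) (ρ : Set V → ℕ) :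
    Prop where
  isotropic : Isotropic L
  add_finrank : ∀ X, ρ X + finrank (ZMod 2) (L ⊓ supportedOn X : Submodule _ _) = X.ncard
  compl : ∀ X, ρ Xᶜ = ρ X

namespace IsCutSystem

variable {L : Submodule (ZMod 2) (V → ZMod 2 × ZMod 2)} {ρ : Set V → ℕ}

theorem submodular (h : IsCutSystem L ρ) (X Y : Set V) :
    ρ (X ∩ Y) + ρ (X ∪ Y) ≤ ρ X + ρ Y := by
  have h1 := Submodule.finrank_sup_add_finrank_inf_eq (L ⊓ supportedOn X) (L ⊓ supportedOn Y)
  rw [← inf_inf_distrib_left, supportedOn_inf] at h1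
  have h2 : (L ⊓ supportedOn X) ⊔ (L ⊓ supportedOn Y) ≤ L ⊓ supportedOn (X ∪ Y) :=
    sup_le (inf_le_inf_left _ (supportedOn_mono Set.subset_union_left))
      (inf_le_inf_left _ (supportedOn_mono Set.subset_union_right))
  have h3 := Submodule.finrank_mono h2
  have h4 := Set.ncard_union_add_ncard_inter X Y
  have := h.add_finrank X
  have := h.add_finrank Y
  have := h.add_finrank (X ∩ Y)
  have := h.add_finrank (X ∪ Y)
  omega

/-- Since `L ⊓ supportedOn X` has dimension `|X| - ρ X`, it must grow when `v` is added without
raising `ρ`. -/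
theorem exists_mem_insert (h : IsCutSystem L ρ) {X : Set V} {v : V} (hv : v ∉ X)
    (hρ : ρ (insert v X) ≤ ρ X) : ∃ x ∈ L, x ∈ supportedOn (insert v X) ∧ x v ≠ 0 := by
  by_contra! hcon
  have h1 : L ⊓ supportedOn (insert v X) ≤ L ⊓ supportedOn X := by
    rintro x ⟨hx, hx'⟩
    refine ⟨hx, fun w hw => ?_⟩
    rcases eq_or_ne w v with rfl | hwv
    · exact hcon x hx hx'
    · exact hx' w (by simp [hw, hwv])
  have h2 := Submodule.finrank_mono h1
  have := h.add_finrank X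
  have := h.add_finrank (insert v X)
  have := Set.ncard_insert_of_notMem hv
  omega

/-- Disjointness makes the restrictions to `X` mutually orthogonal, and they are orthogonal to `L ⊓
supportedOn X` because each `x i` is in `L`. Together these span an isotropic space on `X`, of
dimension at most `|X|`, so modulo `L` the restrictions span at most `ρ X` dimensions. -/
theorem finrank_comap_restrict (h : IsCutSystem L ρ) {m : ℕ} (x : Fin m → V → ZMod 2 × ZMod 2)
    (hx : ∀ i, x i ∈ L) (hdisj : ∀ i j, i ≠ j → ∀ v, x i v = 0 ∨ x j v = 0) (X : Set V) :
    m ≤ finrank (ZMod 2)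
      (L.comap (restrict X ∘ₗ Fintype.linearCombination (ZMod 2) x)) + ρ X := by
  set N := L ⊓ supportedOn X with hN
  set T := restrict X ∘ₗ Fintype.linearCombination (ZMod 2) x with hT
  have hTmem : ∀ c, T c ∈ supportedOn X := fun c => restrict_mem_supportedOn _ _
  have hTsum : ∀ c, T c = ∑ i, c i • restrict X (x i) := by
    intro c; simp [hT, Fintype.linearCombination_apply]
  have hres : ∀ y ∈ N, ∀ z, pairing (restrict X z) y = pairing z y := by
    intro y hy z
    simp only [pairing_apply]
    refine Finset.sum_congr rfl fun v _ => ?_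
    by_cases hv : v ∈ X
    · rw [restrict_of_mem hv]
    · rw [hy.2 v hv, wedge_zero_right, wedge_zero_right]
  have hTN : ∀ c, ∀ y ∈ N, pairing (T c) y = 0 := by
    intro c y hy
    rw [hT, LinearMap.comp_apply, hres y hy]
    refine h.isotropic _ ?_ _ hy.1
    rw [Fintype.linearCombination_apply]
    exact L.sum_mem fun i _ => L.smul_mem _ (hx i)
  have hij : ∀ i j, pairing (restrict X (x i)) (restrict X (x j)) = 0 := by
    intro i j
    rcases eq_or_ne i j with rfl | hne
    · exact pairing_self _
    · refine pairing_eq_zero fun v => ?_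
      by_cases hv : v ∈ X
      · rw [restrict_of_mem hv, restrict_of_mem hv]; exact hdisj i j hne v
      · exact .inl (restrict_of_notMem hv _)
  have hTT : ∀ c d, pairing (T c) (T d) = 0 := by
    intro c d
    simp [hTsum, hij]
  have hiso : Isotropic (LinearMap.range T ⊔ N) := by
    intro a ha b hb
    obtain ⟨_, ⟨c, rfl⟩, y, hy, rfl⟩ := Submodule.mem_sup.1 ha
    obtain ⟨_, ⟨d, rfl⟩, z, hz, rfl⟩ := Submodule.mem_sup.1 hb
    simp only [map_add, LinearMap.add_apply, hTT, hTN c z hz, h.isotropic y hy.1 z hz.1,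
      pairing_comm y, hTN d y hy, add_zero]
  have h1 := hiso.finrank_le_ncard (X := X)
    (sup_le (by rintro _ ⟨c, rfl⟩; exact hTmem c) inf_le_right)
  have h2 := LinearMap.finrank_range_add_finrank_ker (N.mkQ.domRestrict (LinearMap.range T ⊔ N))
  have h3 : LinearMap.ker (N.mkQ.domRestrict (LinearMap.range T ⊔ N)) =
      N.comap (LinearMap.range T ⊔ N).subtype := by
    ext z; simp
  rw [h3, (Submodule.comapSubtypeEquivOfLe (le_sup_right : N ≤ LinearMap.range T ⊔ N)).finrank_eq]
    at h2
  have h4 := LinearMap.finrank_range_add_finrank_ker (N.mkQ ∘ₗ T)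
  have h5 : LinearMap.ker (N.mkQ ∘ₗ T) = L.comap T := by
    ext c
    simp [hN, hTmem c]
  have h6 : LinearMap.range (N.mkQ ∘ₗ T) ≤
      LinearMap.range (N.mkQ.domRestrict (LinearMap.range T ⊔ N)) := by
    rintro _ ⟨c, rfl⟩
    exact ⟨⟨T c, Submodule.mem_sup_left ⟨c, rfl⟩⟩, rfl⟩
  have h7 := Submodule.finrank_mono h6
  rw [h5] at h4
  have h8 : finrank (ZMod 2) (Fin m → ZMod 2) = m := by simp
  have h9 := h.add_finrank X
  rw [← hN] at h9
  omega

end IsCutSystem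

end IsotropicSystem

/-! ### Chains of minimum cuts and critical elements. -/

namespace IsotropicSystem

/-- A finite family of sets that is closed under intersections and unions and separates every
point of `F` from all other points contains a chain adding the points of `F` one by one. -/
theorem exists_separating_chain {V : Type*} [Fintype V] (P : Set V → Prop)
    (hinter : ∀ X Y, P X → P Y → P (X ∩ Y)) (hunion : ∀ X Y, P X → P Y → P (X ∪ Y))
    (F : Set V) (hF : ∀ f ∈ F, ∃ X, f ∉ X ∧ P X ∧ P (insert f X)) :
    ∃ (e : Fin F.ncard → V) (D : Fin F.ncard → Set V), Function.Injective e ∧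
      Set.range e = F ∧ (∀ i, e i ∉ D i ∧ P (D i) ∧ P (insert (e i) (D i))) ∧
      ∀ i j, i < j → insert (e i) (D i) ⊆ D j := by
  classical
  -- `J` is the least member of the family containing `f`. It lies in `insert f X`, so `J \ {f} = J
  -- ∩ X` is again a member.
  have hJ : ∀ f ∈ F, ∃ J, P J ∧ f ∈ J ∧ P (J \ {f}) ∧ ∀ Z, P Z → f ∈ Z → J ⊆ Z := by
    intro f hf
    obtain ⟨X, hfX, hX, hX'⟩ := hF f hf
    obtain ⟨J, ⟨hJ, hfJ⟩, hmin⟩ := Set.exists_min_image {J : Set V | P J ∧ f ∈ J} Set.ncard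
      (Set.toFinite _) ⟨_, hX', Set.mem_insert f X⟩
    have hleast : ∀ Z, P Z → f ∈ Z → J ⊆ Z := by
      intro Z hZ hfZ
      have h1 := hmin (J ∩ Z) ⟨hinter J Z hJ hZ, hfJ, hfZ⟩
      have h2 := Set.eq_of_subset_of_ncard_le Set.inter_subset_left h1
      exact Set.inter_eq_left.1 h2
    refine ⟨J, hJ, hfJ, ?_, hleast⟩
    have h3 : J \ {f} = J ∩ X := by
      ext w
      constructor
      · rintro ⟨hw, hwf⟩
        exact ⟨hw, (hleast _ hX' (Set.mem_insert f X) hw).resolve_left hwf⟩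
      · rintro ⟨hw, hwX⟩
        exact ⟨hw, fun h => hfX (h ▸ hwX)⟩
    rw [h3]
    exact hinter J X hJ hX
  choose! J hJP hfJ hJdiff hleast using hJ
  let e₀ : Fin F.ncard ≃ F := (finCongr (by
    rw [← Nat.card_coe_set_eq, Nat.card_eq_fintype_card])).trans (Fintype.equivFin F).symm
  -- Sorting by the size of `J` ensures that no later point lies in the set `J` of an earlier one.
  let g : Fin F.ncard → ℕ := fun i => (J (e₀ i)).ncard
  let σ := Tuple.sort g
  have hmono : Monotone (g ∘ σ) := Tuple.monotone_sort g
  let e : Fin F.ncard → V := fun i => e₀ (σ i)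
  have heF : ∀ i, e i ∈ F := fun i => (e₀ (σ i)).2
  have hinj : Function.Injective e :=
    Subtype.val_injective.comp (e₀.injective.comp σ.injective)
  have hlt : ∀ i j, e i ∈ J (e j) → i ≤ j := by
    intro i j hij
    by_contra! hji
    have hne : e i ≠ e j := fun h => hji.ne' (hinj h)
    have h1 : J (e i) ⊆ J (e j) \ {e j} := hleast _ (heF i) _ (hJdiff _ (heF j)) ⟨hij, hne⟩
    have h2 : (J (e i)).ncard < (J (e j)).ncard :=
      (Set.ncard_le_ncard h1).trans_lt (Set.ncard_sdiff_singleton_lt_of_mem (hfJ _ (heF j)))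
    exact absurd (hmono hji.le) (not_le.2 h2)
  have hPunion : ∀ B, P B → ∀ s : Finset (Fin F.ncard), P (B ∪ ⋃ j ∈ s, J (e j)) := by
    intro B hB s
    induction s using Finset.induction_on with
    | empty => simpa using hB
    | insert a s _ ih =>
      have : B ∪ ⋃ j ∈ insert a s, J (e j) = (B ∪ ⋃ j ∈ s, J (e j)) ∪ J (e a) := by
        rw [Finset.set_biUnion_insert]
        ext w; simp only [Set.mem_union]; tauto
      rw [this]
      exact hunion _ _ ih (hJP _ (heF a))
  let D : Fin F.ncard → Set V := fun i => (J (e i) \ {e i}) ∪ ⋃ j ∈ Finset.Iio i, J (e j)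
  have hins : ∀ i, insert (e i) (D i) = J (e i) ∪ ⋃ j ∈ Finset.Iio i, J (e j) := by
    intro i
    have : insert (e i) (J (e i) \ {e i}) = J (e i) := by
      rw [Set.insert_sdiff_singleton, Set.insert_eq_of_mem (hfJ _ (heF i))]
    rw [← Set.insert_union, this]
  refine ⟨e, D, hinj, ?_, fun i => ⟨?_, hPunion _ (hJdiff _ (heF i)) _, ?_⟩, ?_⟩
  · ext v
    constructor
    · rintro ⟨i, rfl⟩; exact heF i
    · intro hv
      exact ⟨σ.symm (e₀.symm ⟨v, hv⟩), by simp [e]⟩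
  · simp only [D, Set.mem_union, Set.mem_sdiff, Set.mem_singleton_iff, not_true_eq_false, and_false,
      false_or, Set.mem_iUnion, Finset.mem_Iio, not_exists]
    intro j hj hij
    exact absurd (hlt i j hij) (not_le.2 hj)
  · rw [hins]
    exact hPunion _ (hJP _ (heF i)) _
  · intro i j hij
    rw [hins]
    refine Set.union_subset ?_ (Set.iUnion₂_subset fun a ha => ?_)
    · exact (Set.subset_biUnion_of_mem (u := fun a => J (e a)) (Finset.mem_Iio.2 hij)).trans
        Set.subset_union_right
    · exact (Set.subset_biUnion_of_mem (u := fun a => J (e a))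
        (Finset.mem_Iio.2 ((Finset.mem_Iio.1 ha).trans hij))).trans Set.subset_union_right

variable {V : Type*} {L : Submodule (ZMod 2) (V → ZMod 2 × ZMod 2)} {ρ : Set V → ℕ}
  {k : ℕ} {Q R : Set V}

/-- `X` separates `Q` from `R` and has connectivity `k`. -/
def IsTight (ρ : Set V → ℕ) (k : ℕ) (Q R X : Set V) : Prop :=
  Q ⊆ X ∧ X ⊆ Rᶜ ∧ ρ X = k

/-- Reducing at `v` in the way given by `α` decreases the connectivity between `Q` and `R`. -/
def IsCritical (L : Submodule (ZMod 2) (V → ZMod 2 × ZMod 2)) (ρ : Set V → ℕ) (k : ℕ)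
    (Q R : Set V) (v : V) (α : ZMod 2 × ZMod 2) : Prop :=
  ∃ X, v ∉ X ∧ IsTight ρ k Q R X ∧ IsTight ρ k Q R (insert v X) ∧
    (∃ x ∈ L, x ∈ supportedOn (insert v X) ∧ x v = α) ∧
    ∃ x ∈ L, x ∈ supportedOn Xᶜ ∧ x v = α

namespace IsCutSystem

variable [Fintype V] (h : IsCutSystem L ρ) (hmin : ∀ X, Q ⊆ X → X ⊆ Rᶜ → k ≤ ρ X)
include h hmin

theorem tight_inter_union {X Y : Set V} (hX : IsTight ρ k Q R X) (hY : IsTight ρ k Q R Y) :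
    IsTight ρ k Q R (X ∩ Y) ∧ IsTight ρ k Q R (X ∪ Y) := by
  have hi : Q ⊆ X ∩ Y := Set.subset_inter hX.1 hY.1
  have hi' : X ∩ Y ⊆ Rᶜ := Set.inter_subset_left.trans hX.2.1
  have hu : Q ⊆ X ∪ Y := hX.1.trans Set.subset_union_left
  have hu' : X ∪ Y ⊆ Rᶜ := Set.union_subset hX.2.1 hY.2.1
  have h1 := h.submodular X Y
  have h2 := hmin _ hi hi'
  have h3 := hmin _ hu hu'
  have h4 := hX.2.2
  have h5 := hY.2.2
  exact ⟨⟨hi, hi', by omega⟩, ⟨hu, hu', by omega⟩⟩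

/-- The critical direction is visible at every tight pair `D`, `insert v D`, not only at the one
defining it. Uncrossing gives a member of `L` on `insert v (X ∩ D)` that is nonzero at `v`; it meets
the witness on `Xᶜ` only at `v`, so orthogonality fixes its value there. -/
theorem exists_mem_of_isCritical {v : V} {α : ZMod 2 × ZMod 2} (hα : α ≠ 0)
    (hc : IsCritical L ρ k Q R v α) {D : Set V} (hD : IsTight ρ k Q R D)
    (hD' : IsTight ρ k Q R (insert v D)) :
    ∃ x ∈ L, x ∈ supportedOn (insert v D) ∧ x v = α := by
  obtain ⟨X, hvX, hX, hX', -, z, hzL, hz, hzv⟩ := hc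
  have h1 := (h.tight_inter_union hmin hX hD).1
  have h2 := (h.tight_inter_union hmin hX' hD').1
  rw [← Set.insert_inter_distrib] at h2
  obtain ⟨x, hxL, hx, hxv⟩ := h.exists_mem_insert (X := X ∩ D) (v := v) (fun hh => hvX hh.1)
    (by rw [h1.2.2, h2.2.2])
  refine ⟨x, hxL, supportedOn_mono (Set.insert_subset_insert Set.inter_subset_right) hx, ?_⟩
  have h3 := h.isotropic x hxL z hzL
  rw [pairing_eq_wedge v, hzv] at h3
  · exact eq_of_wedge_eq_zero h3 hxv hα
  · intro w hw
    by_cases hwX : w ∈ X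
    · exact .inr (hz w (by simpa using hwX))
    · exact .inl (hx w (by simp [hw, hwX]))

theorem isCritical_unique {v : V} {α β : ZMod 2 × ZMod 2} (hα : α ≠ 0) (hβ : β ≠ 0)
    (hcα : IsCritical L ρ k Q R v α) (hcβ : IsCritical L ρ k Q R v β) : α = β := by
  obtain ⟨X, hvX, hX, hX', -, z, hzL, hz, hzv⟩ := hcβ
  obtain ⟨x, hxL, hx, hxv⟩ := h.exists_mem_of_isCritical hmin hα hcα hX hX'
  have h3 := h.isotropic x hxL z hzL
  rw [pairing_eq_wedge v, hzv, hxv] at h3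
  · exact eq_of_wedge_eq_zero h3 hα hβ
  · intro w hw
    by_cases hwX : w ∈ X
    · exact .inr (hz w (by simpa using hwX))
    · exact .inl (hx w (by simp [hw, hwX]))

omit hmin in
-- Uncross `C \ A` with `B`, then with `Bᶜ`; the equal values at `A`, `B`, `C` cancel.
theorem strip_le {A B C : Set V} (hAB : A ⊆ B) (hBC : B ⊆ C) (hA : ρ A = k) (hB : ρ B = k)
    (hC : ρ C = k) : ρ (B \ A) ≤ ρ (C \ A) ∧ ρ (C \ B) ≤ ρ (C \ A) := by
  constructor
  · have h1 := h.submodular (C \ A) B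
    have h2 : C \ A ∩ B = B \ A := by
      ext w; simp only [Set.mem_inter_iff, Set.mem_sdiff]
      exact ⟨fun hw => ⟨hw.2, hw.1.2⟩, fun hw => ⟨⟨hBC hw.1, hw.2⟩, hw.1⟩⟩
    have h3 : C \ A ∪ B = C := by
      ext w; simp only [Set.mem_union, Set.mem_sdiff]
      refine ⟨fun hw => hw.elim And.left fun hw => hBC hw, fun hw => ?_⟩
      by_cases hwA : w ∈ A
      · exact .inr (hAB hwA)
      · exact .inl ⟨hw, hwA⟩
    rw [h2, h3] at h1
    omega
  · have h1 := h.submodular (C \ A) Bᶜ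
    have h2 : C \ A ∩ Bᶜ = C \ B := by
      ext w; simp only [Set.mem_inter_iff, Set.mem_sdiff, Set.mem_compl_iff]
      exact ⟨fun hw => ⟨hw.1.1, hw.2⟩, fun hw => ⟨⟨hw.1, fun hA => hw.2 (hAB hA)⟩, hw.2⟩⟩
    have h3 : C \ A ∪ Bᶜ = Aᶜ := by
      ext w; simp only [Set.mem_union, Set.mem_sdiff, Set.mem_compl_iff]
      refine ⟨fun hw => hw.elim And.right fun hw hA => hw (hAB hA), fun hw => ?_⟩
      by_cases hwB : w ∈ B
      · exact .inl ⟨hBC hwB, hw⟩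
      · exact .inr hwB
    rw [h2, h3, h.compl, h.compl] at h1
    omega

/-- A strip containing many critical elements supports a member of `L` whose first coordinate
in `F`, in the order given by `τ`, is not a multiple of the prescribed value `β`. -/
theorem exists_leading {F : Set V} {α β : V → ZMod 2 × ZMod 2} (τ : V → ℕ)
    (hcrit : ∀ f ∈ F, IsCritical L ρ k Q R f (α f)) (hα : ∀ f ∈ F, α f ≠ 0)
    (hβ : ∀ f ∈ F, β f ≠ 0) (hαβ : ∀ f ∈ F, α f ≠ β f) (d : ℕ) {C C' : Set V}
    (hC : IsTight ρ k Q R C) (hC' : IsTight ρ k Q R C') (hCC' : C ⊆ C')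
    (hd : ρ (C' \ C) ≤ d) (hcard : 2 ^ d ≤ (F ∩ (C' \ C)).ncard) :
    ∃ x ∈ L, x ∈ supportedOn (C' \ C) ∧ ∃ f ∈ F, f ∈ C' \ C ∧ wedge (x f) (β f) ≠ 0 ∧
      ∀ g ∈ F, τ g < τ f → x g = 0 := by
  induction d using Nat.strong_induction_on generalizing C C' with
  | h d ih =>
    obtain ⟨f, ⟨hfF, hfC', hfC⟩, hfmin⟩ := Set.exists_min_image (F ∩ (C' \ C)) τ
      (Set.toFinite _) (Set.nonempty_of_ncard_ne_zero (by
        have := Nat.one_le_two_pow.trans hcard; omega))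
    obtain ⟨X, hfX, hX, hX', ⟨y, hyL, hy, hyf⟩, z, hzL, hz, hzf⟩ := hcrit f hfF
    -- The cut that separates `f`, pushed between `C` and `C'`; it splits the strip at `f`.
    set B := X ∩ C' ∪ C with hB
    have hfB : f ∉ B := by simp [hB, hfX, hfC]
    have hBt : IsTight ρ k Q R B :=
      (h.tight_inter_union hmin (h.tight_inter_union hmin hX hC').1 hC).2
    have hBt' : IsTight ρ k Q R (insert f B) := by
      have := (h.tight_inter_union hmin (h.tight_inter_union hmin hX' hC').1 hC).2
      rwa [Set.insert_inter_of_mem hfC', Set.insert_union] at this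
    have hCB : C ⊆ B := Set.subset_union_right
    have hBC' : insert f B ⊆ C' :=
      Set.insert_subset hfC' (Set.union_subset Set.inter_subset_right hCC')
    have hlead : ∀ x ∈ L, x ∈ supportedOn (C' \ C) → x f ≠ 0 → wedge (x f) (α f) = 0 →
        ∃ x ∈ L, x ∈ supportedOn (C' \ C) ∧ ∃ f ∈ F, f ∈ C' \ C ∧ wedge (x f) (β f) ≠ 0 ∧
          ∀ g ∈ F, τ g < τ f → x g = 0 := by
      intro x hxL hx hxf hw
      refine ⟨x, hxL, hx, f, hfF, ⟨hfC', hfC⟩,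
        wedge_ne_zero hw hxf (hα f hfF) (hβ f hfF) (hαβ f hfF), fun g hg hgf => ?_⟩
      by_contra hne
      have : g ∈ C' \ C := by by_contra hgW; exact hne (hx g hgW)
      exact absurd (hfmin g ⟨hg, this⟩) (not_le.2 hgf)
    -- If `f` does not raise the connectivity of the lower part, a member of `L` there is nonzero at
    -- `f` and meets `z` only at `f`, hence has value `α f`. The upper part is symmetric, with `y`
    -- in place of `z`.
    by_cases h1 : ρ (insert f B \ C) ≤ ρ (B \ C)
    · rw [Set.insert_sdiff_of_notMem _ hfC] at h1
      obtain ⟨x, hxL, hx, hxf⟩ := h.exists_mem_insert (fun hh => hfB hh.1) h1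
      rw [← Set.insert_sdiff_of_notMem _ hfC] at hx
      refine hlead x hxL (supportedOn_mono (Set.sdiff_subset_sdiff_left hBC') hx) hxf ?_
      have h2 := h.isotropic x hxL z hzL
      rwa [pairing_eq_wedge f, hzf] at h2
      intro w hw
      by_cases hwX : w ∈ X
      · exact .inr (hz w (by simpa using hwX))
      · refine .inl (hx w ?_)
        simp only [hB, Set.mem_sdiff, Set.mem_insert_iff, Set.mem_union, Set.mem_inter_iff]
        tauto
    by_cases h2 : ρ (C' \ B) ≤ ρ (C' \ insert f B)
    · have h3 : insert f (C' \ insert f B) = C' \ B := by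
        ext w
        simp only [Set.mem_insert_iff, Set.mem_sdiff]
        constructor
        · rintro (rfl | hw)
          · exact ⟨hfC', hfB⟩
          · tauto
        · tauto
      rw [← h3] at h2
      obtain ⟨x, hxL, hx, hxf⟩ := h.exists_mem_insert (fun hh => hh.2 (Set.mem_insert _ _)) h2
      rw [h3] at hx
      refine hlead x hxL (supportedOn_mono (Set.sdiff_subset_sdiff_right hCB) hx) hxf ?_
      have h2 := h.isotropic x hxL y hyL
      rwa [pairing_eq_wedge f, hyf] at h2
      intro w hw
      by_cases hwX : w ∈ X
      · refine .inl (hx w ?_)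
        simp only [hB, Set.mem_sdiff, Set.mem_union, Set.mem_inter_iff]
        tauto
      · exact .inr (hy w (by simp [hw, hwX]))
    -- Now both parts have strictly smaller connectivity than the whole strip.
    have h3 := (h.strip_le (hCB.trans (Set.subset_insert f B)) hBC' hC.2.2 hBt'.2.2 hC'.2.2).1
    have h4 := (h.strip_le hCB ((Set.subset_insert f B).trans hBC') hC.2.2 hBt.2.2 hC'.2.2).2
    obtain _ | d := d
    · omega
    have hsplit : F ∩ (C' \ C) ⊆
        insert f (F ∩ (B \ C) ∪ F ∩ (C' \ insert f B)) := by
      intro w hw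
      simp only [Set.mem_inter_iff, Set.mem_sdiff, Set.mem_insert_iff, Set.mem_union] at hw ⊢
      tauto
    have h5 := (Set.ncard_le_ncard hsplit).trans (Set.ncard_insert_le _ _)
    have h6 := Set.ncard_union_le (F ∩ (B \ C)) (F ∩ (C' \ insert f B))
    -- Without `f`, at least `2 ^ (d + 1) - 1` elements of `F` remain, so one part contains `2 ^ d`
    -- of them.
    rw [pow_succ] at hcard
    rcases le_or_gt (2 ^ d) (F ∩ (B \ C)).ncard with h7 | h7
    · obtain ⟨x, hxL, hx, g, hgF, hg, hxg⟩ := ih d d.lt_succ_self hC hBt hCB (by omega) h7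
      have hsub := Set.sdiff_subset_sdiff_left (t := C) ((Set.subset_insert f B).trans hBC')
      exact ⟨x, hxL, supportedOn_mono hsub hx, g, hgF, hsub hg, hxg⟩
    · obtain ⟨x, hxL, hx, g, hgF, hg, hxg⟩ := ih d d.lt_succ_self hBt' hC' hBC' (by omega) (by omega)
      have hsub : C' \ insert f B ⊆ C' \ C :=
        Set.sdiff_subset_sdiff_right (hCB.trans (Set.subset_insert f B))
      exact ⟨x, hxL, supportedOn_mono hsub hx, g, hgF, hsub hg, hxg⟩

end IsCutSystem

end IsotropicSystem

/-! ### The counting argument for two pairs of sets. -/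

namespace IsotropicSystem

namespace IsCutSystem

variable {V : Type*} [Fintype V] {L : Submodule (ZMod 2) (V → ZMod 2 × ZMod 2)}
  {ρ : Set V → ℕ}

theorem exists_critical_chain (h : IsCutSystem L ρ) {k : ℕ} {Q R F : Set V}
    (hmin : ∀ X, Q ⊆ X → X ⊆ Rᶜ → k ≤ ρ X) {α : V → ZMod 2 × ZMod 2}
    (hcrit : ∀ f ∈ F, IsCritical L ρ k Q R f (α f)) :
    ∃ (e : Fin F.ncard → V) (D : Fin F.ncard → Set V), Function.Injective e ∧
      Set.range e = F ∧ (∀ i, e i ∉ D i ∧ IsTight ρ k Q R (D i) ∧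
        IsTight ρ k Q R (insert (e i) (D i))) ∧
      ∀ i j, i < j → insert (e i) (D i) ⊆ D j :=
  exists_separating_chain (IsTight ρ k Q R)
    (fun _ _ hX hY => (h.tight_inter_union hmin hX hY).1)
    (fun _ _ hX hY => (h.tight_inter_union hmin hX hY).2) F
    (fun f hf => let ⟨X, hfX, hX, hX', _⟩ := hcrit f hf; ⟨X, hfX, hX, hX'⟩)

/-- Disjoint strips, each of which supports a member of `L` with a leading coordinate that is not
a multiple of the prescribed value. -/
theorem exists_disjoint_leading (h : IsCutSystem L ρ) {k m : ℕ} {Q R F : Set V}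
    (hmin : ∀ X, Q ⊆ X → X ⊆ Rᶜ → k ≤ ρ X) {α β : V → ZMod 2 × ZMod 2} (τ : V → ℕ)
    (hcrit : ∀ f ∈ F, IsCritical L ρ k Q R f (α f)) (hα : ∀ f ∈ F, α f ≠ 0)
    (hβ : ∀ f ∈ F, β f ≠ 0) (hαβ : ∀ f ∈ F, α f ≠ β f)
    (hF : m * 2 ^ (2 * k) ≤ F.ncard) :
    ∃ x : Fin m → V → ZMod 2 × ZMod 2, (∀ i, x i ∈ L) ∧ (∀ i, ∀ v ∈ Q ∪ R, x i v = 0) ∧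
      (∀ i j, i ≠ j → ∀ v, x i v = 0 ∨ x j v = 0) ∧
      ∀ i, ∃ f ∈ F, wedge (x i f) (β f) ≠ 0 ∧ ∀ g ∈ F, τ g < τ f → x i g = 0 := by
  obtain ⟨e, D, hinj, hrange, hD, hchain⟩ := h.exists_critical_chain hmin hcrit
  set N := 2 ^ (2 * k) with hN
  have hN0 : 0 < N := by positivity
  have hmul : ∀ i : Fin m, (i : ℕ) * N + N ≤ F.ncard := fun i =>
    (by nlinarith [i.2] : (i : ℕ) * N + N ≤ m * N).trans hF
  let a : Fin m → Fin F.ncard := fun i => ⟨i * N, by have := hmul i; omega⟩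
  let b : Fin m → Fin F.ncard := fun i => ⟨i * N + (N - 1), by have := hmul i; omega⟩
  let W : Fin m → Set V := fun i => insert (e (b i)) (D (b i)) \ D (a i)
  have hab : ∀ i, a i ≤ b i := fun i => by simp [a, b]
  have hDmono : ∀ i j, i ≤ j → D i ⊆ D j := by
    intro i j hij
    rcases hij.eq_or_lt with rfl | hij
    · exact subset_rfl
    · exact (Set.subset_insert _ _).trans (hchain i j hij)
  have hmem : ∀ i j, i ≤ j → e i ∈ insert (e j) (D j) := by
    intro i j hij
    rcases hij.eq_or_lt with rfl | hij
    · exact Set.mem_insert _ _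
    · exact Set.mem_insert_of_mem _ (hchain i j hij (Set.mem_insert _ _))
  have hdisj : ∀ i j, i < j → ∀ v, v ∉ W i ∨ v ∉ W j := by
    intro i j hij v
    have hlt : b i < a j := by
      have : ((i : ℕ) + 1) * N ≤ j * N := Nat.mul_le_mul_right _ hij
      simp only [a, b, Fin.mk_lt_mk]
      rw [add_mul] at this
      omega
    by_contra! hv
    exact hv.2.2 (hchain _ _ hlt hv.1.1)
  have hstrip : ∀ i, ∃ x ∈ L, x ∈ supportedOn (W i) ∧ ∃ f ∈ F, f ∈ W i ∧
      wedge (x f) (β f) ≠ 0 ∧ ∀ g ∈ F, τ g < τ f → x g = 0 := by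
    intro i
    have hsub : D (a i) ⊆ insert (e (b i)) (D (b i)) :=
      (hDmono _ _ (hab i)).trans (Set.subset_insert _ _)
    refine h.exists_leading hmin τ hcrit hα hβ hαβ (2 * k) (hD (a i)).2.1 (hD (b i)).2.2 hsub ?_ ?_
    -- A strip between two cuts of connectivity `k` has connectivity at most `2 * k`.
    · have h1 := h.submodular (insert (e (b i)) (D (b i))) (D (a i))ᶜ
      rw [h.compl, (hD (a i)).2.1.2.2, (hD (b i)).2.2.2.2] at h1
      rw [Set.sdiff_eq]
      omega
    · have h1 : e '' (Finset.Icc (a i) (b i) : Finset _) ⊆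
          F ∩ (insert (e (b i)) (D (b i)) \ D (a i)) := by
        rintro _ ⟨j, hj, rfl⟩
        rw [Finset.mem_coe, Finset.mem_Icc] at hj
        refine ⟨hrange ▸ Set.mem_range_self j, hmem _ _ hj.2, fun hja => (hD j).1 ?_⟩
        exact hDmono _ _ hj.1 hja
      have h2 := Set.ncard_le_ncard h1
      rw [Set.ncard_image_of_injective _ hinj, Set.ncard_coe_finset, Fin.card_Icc] at h2
      refine le_trans ?_ h2
      simp only [a, b]
      omega
  choose x hxL hxW f hfF hfW hxf hxg using hstrip
  refine ⟨x, hxL, fun i v hv => hxW i v ?_, fun i j hij v => ?_,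
    fun i => ⟨f i, hfF i, hxf i, hxg i⟩⟩
  · rintro ⟨hv1, hv2⟩
    rcases hv with hv | hv
    · exact hv2 ((hD (a i)).2.1.1 hv)
    · exact (hD (b i)).2.2.2.1 hv1 hv
  · rcases hij.lt_or_gt with hij | hij
    · exact (hdisj i j hij v).imp (hxW i v) (hxW j v)
    · exact ((hdisj j i hij v).imp (hxW j v) (hxW i v)).symm

/-- Each of the two conditions costs at most `l` dimensions of coefficients. -/
theorem exists_restrict_mem (h : IsCutSystem L ρ) {l m : ℕ} (hm : 2 * l < m)
    (x : Fin m → V → ZMod 2 × ZMod 2) (hx : ∀ i, x i ∈ L)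
    (hdisj : ∀ i j, i ≠ j → ∀ v, x i v = 0 ∨ x j v = 0) {S T : Set V} (hS : ρ S = l)
    (hT : ρ T = l) :
    ∃ c : Fin m → ZMod 2, c ≠ 0 ∧ restrict S (∑ i, c i • x i) ∈ L ∧
      restrict T (∑ i, c i • x i) ∈ L := by
  have h1 := h.finrank_comap_restrict x hx hdisj S
  have h2 := h.finrank_comap_restrict x hx hdisj T
  set A := L.comap (restrict S ∘ₗ Fintype.linearCombination (ZMod 2) x)
  set B := L.comap (restrict T ∘ₗ Fintype.linearCombination (ZMod 2) x)
  have h3 := Submodule.finrank_sup_add_finrank_inf_eq A B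
  have h4 := (A ⊔ B).finrank_le
  rw [Module.finrank_fin_fun] at h4
  have h5 : A ⊓ B ≠ ⊥ := by
    intro hbot
    rw [hbot, finrank_bot] at h3
    omega
  obtain ⟨c, ⟨hcA, hcB⟩, hc⟩ := Submodule.exists_mem_ne_zero_of_ne_bot h5
  exact ⟨c, hc, by simpa [A, Fintype.linearCombination_apply] using hcA,
    by simpa [B, Fintype.linearCombination_apply] using hcB⟩

/-- Two pairs of sets for which every remaining element is critical in two different ways
leave few elements. -/
theorem ncard_lt_of_isCritical (h : IsCutSystem L ρ) {k l : ℕ} {Q R S T : Set V}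
    (hminQR : ∀ X, Q ⊆ X → X ⊆ Rᶜ → k ≤ ρ X) (hminST : ∀ X, S ⊆ X → X ⊆ Tᶜ → l ≤ ρ X)
    (α β : V → ZMod 2 × ZMod 2)
    (hcritQR : ∀ f ∈ (Q ∪ R ∪ S ∪ T)ᶜ, IsCritical L ρ k Q R f (α f))
    (hcritST : ∀ f ∈ (Q ∪ R ∪ S ∪ T)ᶜ, IsCritical L ρ l S T f (β f))
    (hα : ∀ f ∈ (Q ∪ R ∪ S ∪ T)ᶜ, α f ≠ 0) (hβ : ∀ f ∈ (Q ∪ R ∪ S ∪ T)ᶜ, β f ≠ 0)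
    (hαβ : ∀ f ∈ (Q ∪ R ∪ S ∪ T)ᶜ, α f ≠ β f) :
    (Q ∪ R ∪ S ∪ T)ᶜ.ncard < (2 * l + 1) * 2 ^ (2 * k) := by
  classical
  by_contra! hF
  set F := (Q ∪ R ∪ S ∪ T)ᶜ with hFdef
  obtain ⟨e, D, hinj, hrange, hD, hchain⟩ := h.exists_critical_chain hminST hcritST
  -- The position in the `(S, T)`-chain; the value `0` off `F` is irrelevant, as only elements of
  -- `F` are compared.
  set τ : V → ℕ := Function.extend e (fun i => (i : ℕ)) 0
  have hτ : ∀ i, τ (e i) = i := fun i => hinj.extend_apply _ _ i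
  have hpos : 0 < F.ncard := lt_of_lt_of_le (by positivity) hF
  obtain ⟨x, hxL, hxQR, hdisj, hlead⟩ :=
    h.exists_disjoint_leading hminQR τ hcritQR hα hβ hαβ hF
  choose f hfF hxf hxg using hlead
  let first : Fin F.ncard := ⟨0, hpos⟩
  let last : Fin F.ncard := ⟨F.ncard - 1, by omega⟩
  set S' := D first
  set T' := (insert (e last) (D last))ᶜ with hT'
  have hDmono : ∀ i j, i ≤ j → D i ⊆ D j := by
    intro i j hij
    rcases hij.eq_or_lt with rfl | hij
    · exact subset_rfl
    · exact (Set.subset_insert _ _).trans (hchain i j hij)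
  have hfirst : ∀ i, first ≤ i := fun i => Nat.zero_le _
  have hlast : ∀ i, i ≤ last := fun i => by
    simp only [last, Fin.le_def]; have := i.2; omega
  obtain ⟨c, hc, hcS, hcT⟩ := h.exists_restrict_mem (l := l) (by omega) x hxL hdisj
    (S := S') (T := T') (hD first).2.1.2.2 (by rw [hT', h.compl]; exact (hD last).2.2.2.2)
  set y := ∑ i, c i • x i with hy
  have hyL : y ∈ L := L.sum_mem fun i _ => L.smul_mem _ (hxL i)
  have hyv : ∀ v, y v = ∑ i, c i • x i v := fun v => by simp [hy]
  -- Clearing `y` on both ends of the chain stays in `L`. As `S ⊆ S'`, `T ⊆ T'` and `y` vanishes on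
  -- `Q ∪ R`, the support of `z` lies in `F`.
  set z := y - restrict S' y - restrict T' y with hz
  have hzL : z ∈ L := L.sub_mem (L.sub_mem hyL hcS) hcT
  have hST' : ∀ v, v ∈ S' → v ∉ T' := fun v hv hv' =>
    hv' (Set.mem_insert_of_mem _ (hDmono _ _ (hfirst last) hv))
  have hz0 : ∀ v, v ∈ S' ∨ v ∈ T' → z v = 0 := by
    intro v hv
    by_cases hvS : v ∈ S'
    · simp [hz, restrict_of_mem hvS, restrict_of_notMem (hST' v hvS)]
    · have hvT := hv.resolve_left hvS
      simp [hz, restrict_of_mem hvT, restrict_of_notMem hvS]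
  have hzy : ∀ v, v ∉ S' → v ∉ T' → z v = y v := by
    intro v hvS hvT
    simp [hz, restrict_of_notMem hvS, restrict_of_notMem hvT]
  obtain ⟨i₁, hi₁⟩ := Function.ne_iff.1 hc
  -- The earliest leading element among the summands that occur; no other summand reaches it, by
  -- disjointness.
  obtain ⟨i, hi, himin⟩ := Finset.exists_min_image (Finset.univ.filter fun i => c i ≠ 0)
    (fun i => τ (f i)) ⟨i₁, by simpa using hi₁⟩
  simp only [Finset.mem_filter, Finset.mem_univ, true_and] at hi himin
  have hci : c i = 1 := by
    revert hi; generalize c i = a; revert a; decide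
  obtain ⟨j, hj⟩ : f i ∈ Set.range e := by rw [hrange]; exact hfF i
  have hxfi : x i (f i) ≠ 0 := fun h0 => hxf i (by rw [h0, wedge_zero_left])
  have hyf : y (f i) = x i (f i) := by
    rw [hyv, Finset.sum_eq_single i, hci, one_smul]
    · intro i' _ hne
      rw [(hdisj i i' hne.symm (f i)).resolve_left hxfi, smul_zero]
    · simp
  have hzf : z (f i) = x i (f i) := by
    rw [hzy, hyf]
    · rw [← hj]
      exact fun hS => (hD j).1 (hDmono _ _ (hfirst j) hS)
    · rw [← hj]
      refine fun hT => hT ?_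
      rcases (hlast j).eq_or_lt with hjl | hjl
      · rw [hjl]; exact Set.mem_insert _ _
      · exact Set.mem_insert_of_mem _ (hchain _ _ hjl (Set.mem_insert _ _))
  -- `w` lives on the chain up to `f i`, where `z` vanishes except at `f i`.
  obtain ⟨w, hwL, hw, hwf⟩ := h.exists_mem_of_isCritical hminST (hβ _ (hfF i))
    (hcritST _ (hfF i)) (D := D j) (hD j).2.1
    (by rw [← hj]; exact (hD j).2.2)
  have hpair := h.isotropic z hzL w hwL
  rw [pairing_eq_wedge (f i), hzf, hwf] at hpair
  · exact hxf i hpair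
  intro v hv
  by_cases hvD : v ∈ D j
  · left
    by_cases hvST : v ∈ S' ∨ v ∈ T'
    · exact hz0 v hvST
    push Not at hvST
    rw [hzy v hvST.1 hvST.2, hyv]
    refine Finset.sum_eq_zero fun i' _ => ?_
    by_cases hvQR : v ∈ Q ∪ R
    · rw [hxQR i' v hvQR, smul_zero]
    have hvF : v ∈ F := by
      have hvS : v ∉ S := fun hh => hvST.1 ((hD first).2.1.1 hh)
      have hvT : v ∉ T := fun hh => hvST.2 fun hins => (hD last).2.2.2.1 hins hh
      simp only [hFdef, Set.mem_compl_iff, Set.mem_union] at hvQR ⊢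
      tauto
    obtain ⟨j', rfl⟩ : v ∈ Set.range e := by rw [hrange]; exact hvF
    have hj' : j' < j := by
      by_contra! hle
      exact (hD j').1 (hDmono _ _ hle hvD)
    by_cases hci' : c i' = 0
    · rw [hci', zero_smul]
    · rw [hxg i' _ hvF, smul_zero]
      refine lt_of_lt_of_le ?_ (himin i' hci')
      rw [← hj, hτ, hτ]
      exact hj'
  · exact .inr (hw v (by simp [hv, hvD]))

end IsCutSystem

end IsotropicSystem

/-! ### The isotropic system of a graph. -/

namespace SimpleGraph

open IsotropicSystem

variable {V : Type*}

open Classical in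
/-- The adjacency matrix over the binary field. -/
noncomputable def binaryAdj (G : SimpleGraph V) : Matrix V V (ZMod 2) := G.adjMatrix (ZMod 2)

open Classical in
theorem binaryAdj_apply (G : SimpleGraph V) (v w : V) :
    G.binaryAdj v w = if G.Adj v w then 1 else 0 := adjMatrix_apply G v w

theorem binaryAdj_comm (G : SimpleGraph V) (v w : V) : G.binaryAdj v w = G.binaryAdj w v := by
  classical
  rw [binaryAdj_apply, binaryAdj_apply]
  exact if_congr (G.adj_comm v w) rfl rfl

theorem binaryAdj_self (G : SimpleGraph V) (v : V) : G.binaryAdj v v = 0 := by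
  simp [binaryAdj_apply]

open Classical in
theorem binaryAdj_localComplement (G : SimpleGraph V) (v x y : V) :
    (G.localComplement v).binaryAdj x y = G.binaryAdj x y + G.binaryAdj v x * G.binaryAdj v y +
      if x = y then G.binaryAdj v x else 0 := by
  have h2 : (1 : ZMod 2) + 1 = 0 := by decide
  simp only [binaryAdj_apply, localComplement]
  by_cases hxy : x = y
  · subst hxy
    by_cases h : G.Adj v x <;> simp [h, h2]
  · by_cases h : G.Adj v x <;> by_cases h' : G.Adj v y <;> by_cases h'' : G.Adj x y <;>
      simp [h, h', h'', hxy, h2, Xor]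

variable [Fintype V]

/-- The linear map whose range is the isotropic system of `G`. -/
noncomputable def graphMap (G : SimpleGraph V) :
    (V → ZMod 2) →ₗ[ZMod 2] (V → ZMod 2 × ZMod 2) where
  toFun a v := (a v, G.binaryAdj.mulVec a v)
  map_add' a b := by ext v <;> simp [Matrix.mulVec_add]
  map_smul' c a := by ext v <;> simp [Matrix.mulVec_smul]

theorem graphMap_apply (G : SimpleGraph V) (a : V → ZMod 2) (v : V) :
    G.graphMap a v = (a v, G.binaryAdj.mulVec a v) := rfl

theorem graphMap_injective (G : SimpleGraph V) : Function.Injective G.graphMap := fun _ _ h =>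
  funext fun v => congrArg Prod.fst (congrFun h v)

/-- The isotropic system of `G`. -/
noncomputable def lagrangian (G : SimpleGraph V) :
    Submodule (ZMod 2) (V → ZMod 2 × ZMod 2) :=
  LinearMap.range G.graphMap

theorem finrank_lagrangian (G : SimpleGraph V) :
    finrank (ZMod 2) G.lagrangian = Fintype.card V := by
  rw [lagrangian, LinearMap.finrank_range_of_inj G.graphMap_injective, finrank_fintype_fun_eq_card]

theorem cutRank_eq (G : SimpleGraph V) (X : Set V) [Fintype (Xᶜ : Set V)] :
    G.cutRank X = (G.binaryAdj.submatrix (fun i : X => (i : V))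
      (fun j : (Xᶜ : Set V) => (j : V))).rank := by
  rw [cutRank, binaryAdj]
  congr!

theorem cutRank_eq_swap (G : SimpleGraph V) (X : Set V) [Fintype X] :
    G.cutRank X = (G.binaryAdj.submatrix (fun i : (Xᶜ : Set V) => (i : V))
      (fun j : X => (j : V))).rank := by
  classical
  rw [cutRank_eq, ← Matrix.rank_transpose, Matrix.transpose_submatrix]
  congr! 2
  ext v w
  exact G.binaryAdj_comm w v

theorem cutRank_compl (G : SimpleGraph V) (X : Set V) : G.cutRank Xᶜ = G.cutRank X := by
  classical
  rw [cutRank_eq_swap, cutRank_eq]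
  let e : X ≃ (Xᶜᶜ : Set V) := Equiv.setCongr (compl_compl X).symm
  exact (Matrix.rank_submatrix (G.binaryAdj.submatrix (fun i : (Xᶜᶜ : Set V) => (i : V))
    (fun j : (Xᶜ : Set V) => (j : V))) e (Equiv.refl _)).symm

theorem sum_subtype_eq {X : Set V} [Fintype X] (f : V → ZMod 2) (a : X → ZMod 2) :
    ∑ v, f v * Function.ExtendByZero.linearMap (ZMod 2) Subtype.val a v = ∑ x : X, f x * a x := by
  classical
  have h0 : ∀ v ∉ X, Function.ExtendByZero.linearMap (ZMod 2) Subtype.val a v = 0 := by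
    intro v hv
    rw [Function.ExtendByZero.linearMap_apply, Function.extend_apply']
    · rfl
    · rintro ⟨x, rfl⟩; exact hv x.2
  rw [← Finset.sum_subset (Finset.subset_univ X.toFinset)]
  · rw [← Finset.sum_coe_sort X.toFinset]
    refine Fintype.sum_equiv (Equiv.subtypeEquivRight (by simp)) _ _ (fun x => ?_)
    rw [Function.ExtendByZero.linearMap_apply]
    congr 1
    exact Subtype.val_injective.extend_apply a 0 ⟨x, Set.mem_toFinset.1 x.2⟩
  · intro v _ hv
    rw [h0 v (by simpa using hv), mul_zero]

/-- Members of `L` supported on `X` correspond to the kernel of the `Xᶜ × X` block of the adjacency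
matrix, so this is rank-nullity. -/
theorem cutRank_add_finrank (G : SimpleGraph V) (X : Set V) :
    G.cutRank X + finrank (ZMod 2) (G.lagrangian ⊓ supportedOn X : Submodule _ _) = X.ncard := by
  classical
  set N := G.binaryAdj.submatrix (fun i : (Xᶜ : Set V) => (i : V)) (fun j : X => (j : V)) with hN
  let ext' := Function.ExtendByZero.linearMap (ZMod 2) (Subtype.val : X → V)
  have hext : ∀ a (x : X), ext' a x = a x := fun a x => Subtype.val_injective.extend_apply a 0 x
  have hext0 : ∀ a, ∀ v ∉ X, ext' a v = 0 := by
    intro a v hv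
    exact Function.extend_apply' _ _ _ (by rintro ⟨x, rfl⟩; exact hv x.2)
  have hmul : ∀ a (v : (Xᶜ : Set V)), G.binaryAdj.mulVec (ext' a) v = N.mulVec a v := fun a v =>
    sum_subtype_eq (fun w => G.binaryAdj v w) a
  let ψ := (G.graphMap ∘ₗ ext').domRestrict (LinearMap.ker N.mulVecLin)
  have hinj : Function.Injective ψ := by
    intro a b hab
    ext x
    rw [← hext a x, ← hext b x]
    exact congrFun (G.graphMap_injective hab) x
  have hrange : LinearMap.range ψ = G.lagrangian ⊓ supportedOn X := by
    ext y
    constructor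
    · rintro ⟨a, rfl⟩
      refine ⟨⟨_, rfl⟩, fun v hv => Prod.ext (hext0 _ v hv) ?_⟩
      exact (hmul a ⟨v, hv⟩).trans (congrFun (LinearMap.mem_ker.1 a.2) ⟨v, hv⟩)
    · rintro ⟨⟨b, rfl⟩, hy⟩
      have hb : ext' (fun x => b x) = b := by
        funext v
        by_cases hv : v ∈ X
        · exact hext _ ⟨v, hv⟩
        · rw [hext0 _ v hv]; exact (congrArg Prod.fst (hy v hv)).symm
      refine ⟨⟨fun x => b x, ?_⟩, ?_⟩
      · rw [LinearMap.mem_ker]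
        funext v
        rw [Matrix.mulVecLin_apply, ← hmul, hb]
        exact congrArg Prod.snd (hy v v.2)
      · change G.graphMap (ext' fun x => b x) = _
        rw [hb]
  have h1 := LinearMap.finrank_range_add_finrank_ker N.mulVecLin
  rw [finrank_fintype_fun_eq_card, ← Matrix.rank, hN, ← cutRank_eq_swap, ← hN,
    ← LinearMap.finrank_range_of_inj hinj, hrange] at h1
  rw [h1, ← Nat.card_coe_set_eq, Nat.card_eq_fintype_card]

theorem isCutSystem (G : SimpleGraph V) : IsCutSystem G.lagrangian G.cutRank where
  isotropic := by
    rintro _ ⟨a, rfl⟩ _ ⟨b, rfl⟩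
    have h1 : G.binaryAdj.transpose = G.binaryAdj := by
      ext v w; exact G.binaryAdj_comm w v
    have h2 : a ⬝ᵥ G.binaryAdj.mulVec b = G.binaryAdj.mulVec a ⬝ᵥ b := by
      rw [Matrix.dotProduct_mulVec, ← Matrix.mulVec_transpose, h1]
    simp only [pairing_apply, graphMap_apply, wedge, Finset.sum_add_distrib]
    change a ⬝ᵥ G.binaryAdj.mulVec b + G.binaryAdj.mulVec a ⬝ᵥ b = 0
    rw [h2]
    exact CharTwo.add_self_eq_zero _
  add_finrank := G.cutRank_add_finrank
  compl := G.cutRank_compl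

/-! ### Local complementation and pivoting as coordinatewise symplectic maps. -/

/-- `Φ` acts on every coordinate separately and sends the isotropic system of `G` to that
of `G'`. -/
structure IsLocalEquiv (G G' : SimpleGraph V)
    (Φ : (V → ZMod 2 × ZMod 2) →ₗ[ZMod 2] (V → ZMod 2 × ZMod 2)) : Prop where
  eq_zero_iff : ∀ x v, Φ x v = 0 ↔ x v = 0
  map_mem : ∀ x ∈ G.lagrangian, Φ x ∈ G'.lagrangian

namespace IsLocalEquiv

variable {G G' G'' : SimpleGraph V}
  {Φ Ψ : (V → ZMod 2 × ZMod 2) →ₗ[ZMod 2] (V → ZMod 2 × ZMod 2)}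

theorem comp (hΨ : IsLocalEquiv G' G'' Ψ) (hΦ : IsLocalEquiv G G' Φ) :
    IsLocalEquiv G G'' (Ψ ∘ₗ Φ) :=
  ⟨fun x v => (hΨ.eq_zero_iff _ v).trans (hΦ.eq_zero_iff x v),
    fun x hx => hΨ.map_mem _ (hΦ.map_mem x hx)⟩

theorem injective (hΦ : IsLocalEquiv G G' Φ) : Function.Injective Φ := by
  rw [injective_iff_map_eq_zero]
  intro x hx
  funext v
  exact (hΦ.eq_zero_iff x v).1 (congrFun hx v)

theorem map_lagrangian (hΦ : IsLocalEquiv G G' Φ) : G.lagrangian.map Φ = G'.lagrangian := by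
  refine Submodule.eq_of_le_of_finrank_eq (Submodule.map_le_iff_le_comap.2 hΦ.map_mem) ?_
  rw [← (Submodule.equivMapOfInjective Φ hΦ.injective _).finrank_eq, finrank_lagrangian, finrank_lagrangian]

theorem exists_preimage (hΦ : IsLocalEquiv G G' Φ) {y : V → ZMod 2 × ZMod 2}
    (hy : y ∈ G'.lagrangian) : ∃ x ∈ G.lagrangian, Φ x = y := by
  rwa [← hΦ.map_lagrangian] at hy

theorem cutRank_eq (hΦ : IsLocalEquiv G G' Φ) (X : Set V) : G'.cutRank X = G.cutRank X := by
  have h1 : (G.lagrangian ⊓ supportedOn X).map Φ = G'.lagrangian ⊓ supportedOn X := by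
    ext y
    constructor
    · rintro ⟨x, ⟨hx, hx'⟩, rfl⟩
      exact ⟨hΦ.map_mem x hx, fun v hv => (hΦ.eq_zero_iff x v).2 (hx' v hv)⟩
    · rintro ⟨hy, hy'⟩
      obtain ⟨x, hx, rfl⟩ := hΦ.exists_preimage hy
      exact ⟨x, ⟨hx, fun v hv => (hΦ.eq_zero_iff x v).1 (hy' v hv)⟩, rfl⟩
  have h2 := G.cutRank_add_finrank X
  have h3 := G'.cutRank_add_finrank X
  rw [← h1, ← (Submodule.equivMapOfInjective Φ hΦ.injective _).finrank_eq] at h3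
  omega

theorem isCritical (hΦ : IsLocalEquiv G G' Φ) {k : ℕ} {Q R : Set V} {v : V}
    {α β : ZMod 2 × ZMod 2} (hαβ : ∀ x, Φ x v = α → x v = β)
    (h : IsCritical G'.lagrangian G'.cutRank k Q R v α) :
    IsCritical G.lagrangian G.cutRank k Q R v β := by
  have hρ : G'.cutRank = G.cutRank := funext hΦ.cutRank_eq
  obtain ⟨X, hvX, hX, hX', ⟨y, hyL, hy, hyv⟩, z, hzL, hz, hzv⟩ := h
  obtain ⟨y, hyL', rfl⟩ := hΦ.exists_preimage hyL
  obtain ⟨z, hzL', rfl⟩ := hΦ.exists_preimage hzL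
  rw [hρ] at hX hX'
  exact ⟨X, hvX, hX, hX',
    ⟨y, hyL', fun w hw => (hΦ.eq_zero_iff y w).1 (hy w hw), hαβ y hyv⟩,
    z, hzL', fun w hw => (hΦ.eq_zero_iff z w).1 (hz w hw), hαβ z hzv⟩

end IsLocalEquiv

omit [Fintype V] in
theorem localComplement_adj (G : SimpleGraph V) (v x y : V) :
    (G.localComplement v).Adj x y ↔ x ≠ y ∧ Xor (G.Adj x y) (G.Adj v x ∧ G.Adj v y) := Iff.rfl

open Classical in
/-- The action of the local complementation at `v` on the isotropic system. -/
noncomputable def localComplementMap (G : SimpleGraph V) (v : V) :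
    (V → ZMod 2 × ZMod 2) →ₗ[ZMod 2] (V → ZMod 2 × ZMod 2) where
  toFun x w := ((x w).1 + (if w = v then 1 else 0) * (x w).2,
    (x w).2 + G.binaryAdj v w * (x w).1)
  map_add' x y := by
    ext w <;> simp only [Pi.add_apply, Prod.fst_add, Prod.snd_add] <;> ring
  map_smul' c x := by
    ext w <;> simp only [Pi.smul_apply, Prod.smul_fst, Prod.smul_snd, smul_eq_mul,
      RingHom.id_apply] <;> ring

omit [Fintype V] in
open Classical in
theorem localComplementMap_apply (G : SimpleGraph V) (v : V) (x : V → ZMod 2 × ZMod 2) (w : V) :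
    G.localComplementMap v x w = ((x w).1 + (if w = v then 1 else 0) * (x w).2,
      (x w).2 + G.binaryAdj v w * (x w).1) := rfl

theorem isLocalEquiv_localComplement (G : SimpleGraph V) (v : V) :
    IsLocalEquiv G (G.localComplement v) (G.localComplementMap v) := by
  classical
  constructor
  · intro x w
    rw [localComplementMap_apply]
    by_cases hw : w = v
    · subst hw
      rw [binaryAdj_self, if_pos rfl]
      generalize x w = p
      revert p; decide
    · rw [if_neg hw]
      generalize x w = p
      generalize G.binaryAdj v w = q
      revert p q; decide
  · rintro _ ⟨a, rfl⟩
    -- Only the first coordinate at `v` changes under the shear, by the second coordinate there.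
    refine ⟨fun w => a w + (if w = v then 1 else 0) * G.binaryAdj.mulVec a w, ?_⟩
    funext w
    rw [localComplementMap_apply, graphMap_apply, graphMap_apply]
    refine Prod.ext rfl ?_
    have h1 : (G.localComplement v).binaryAdj w v = G.binaryAdj v w := by
      rw [binaryAdj_localComplement, binaryAdj_self, binaryAdj_comm]
      by_cases hw : w = v
      · subst hw; simp [binaryAdj_self]
      · simp [hw]
    simp only [Matrix.mulVec, dotProduct, mul_add, Finset.sum_add_distrib]
    have h2 : ∑ u, (G.localComplement v).binaryAdj w u *
        ((if u = v then 1 else 0) * ∑ t, G.binaryAdj u t * a t) =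
        G.binaryAdj v w * ∑ t, G.binaryAdj v t * a t := by
      rw [Finset.sum_eq_single v (fun u _ hu => by simp [hu]) (by simp), if_pos rfl, one_mul, h1]
    have h3 : ∑ u, (G.localComplement v).binaryAdj w u * a u =
        ∑ u, G.binaryAdj w u * a u + G.binaryAdj v w * ∑ t, G.binaryAdj v t * a t +
          G.binaryAdj v w * a w := by
      simp only [binaryAdj_localComplement, add_mul, Finset.sum_add_distrib, Finset.mul_sum,
        mul_assoc, ite_mul, zero_mul, Finset.sum_ite_eq, Finset.mem_univ, if_true]
    have h4 : ∀ p q r : ZMod 2, p + q + r + q = p + r := by decide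
    rw [h2, h3]
    exact h4 _ _ _

/-- The vertices `u`, `v` stay adjacent throughout, so the three shears act on the plane at `v` and
compose to the swap of its coordinates. -/
theorem exists_isLocalEquiv_pivot (G : SimpleGraph V) {u v : V} (huv : G.Adj u v) :
    ∃ Φ, IsLocalEquiv G (G.pivot u v) Φ ∧ ∀ x, Φ x v = (0, 1) → x v = (1, 0) := by
  classical
  refine ⟨_, ((isLocalEquiv_localComplement _ u).comp
    ((isLocalEquiv_localComplement _ v).comp (isLocalEquiv_localComplement G u))), fun x => ?_⟩
  have h1 : (G.localComplement u).Adj u v := by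
    simp [localComplement_adj, huv, huv.ne, Xor]
  have h2 : ((G.localComplement u).localComplement v).Adj u v := by
    rw [localComplement_adj]
    simp [h1, huv.ne, Xor]
  simp only [LinearMap.comp_apply, localComplementMap_apply, binaryAdj_self, if_pos,
    binaryAdj_apply _ u v, if_pos huv, if_pos h2, if_neg huv.ne']
  generalize x v = p
  revert p; decide

/-! ### Failed reductions produce critical vertices. -/

theorem le_cutRank {G : SimpleGraph V} {k : ℕ} {Q R : Set V} (hk : G.cutConnectivity Q R = k)
    (X : Set V) (hX : Q ⊆ X) (hX' : X ⊆ Rᶜ) : k ≤ G.cutRank X :=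
  hk ▸ Nat.sInf_le ⟨X, hX, hX', rfl⟩

theorem exists_cutRank_eq (G : SimpleGraph V) {Q R : Set V} (h : Disjoint Q R) :
    ∃ X, Q ⊆ X ∧ X ⊆ Rᶜ ∧ G.cutRank X = G.cutConnectivity Q R :=
  Nat.sInf_mem (s := {n : ℕ | ∃ X : Set V, Q ⊆ X ∧ X ⊆ Rᶜ ∧ G.cutRank X = n})
    ⟨_, Q, subset_rfl, h.subset_compl_right, rfl⟩

omit [Fintype V] in
theorem binaryAdj_deleteVertex (G : SimpleGraph V) (v : V) (x y : ({v}ᶜ : Set V)) :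
    (G.deleteVertex v).binaryAdj x y = G.binaryAdj x y := by
  classical
  rw [binaryAdj_apply, binaryAdj_apply]
  exact if_congr Iff.rfl rfl rfl

theorem cutRank_deleteVertex_le (G : SimpleGraph V) (v : V) [Fintype ({v}ᶜ : Set V)]
    (X : Set V) : (G.deleteVertex v).cutRank (Subtype.val ⁻¹' X) ≤ G.cutRank X := by
  classical
  rw [cutRank_eq, cutRank_eq]
  refine le_of_eq_of_le ?_ (Matrix.rank_submatrix_le _
    (fun i : (Subtype.val ⁻¹' X : Set ({v}ᶜ : Set V)) => (⟨i.1.1, i.2⟩ : X))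
    (fun j : ((Subtype.val ⁻¹' X)ᶜ : Set ({v}ᶜ : Set V)) => (⟨j.1.1, j.2⟩ : (Xᶜ : Set V))))
  congr 1

/-- Members for `G \ v` on `X` lift to members for `G` with first coordinate `0` at `v`. There are
too many of them to vanish at `v`, given the rank of `X` in `G`, and a nonzero value with first
coordinate `0` is `(0, 1)`. -/
theorem exists_mem_of_cutRank_deleteVertex_lt (G : SimpleGraph V) {v : V}
    [Fintype ({v}ᶜ : Set V)] {l : ℕ} {X : Set ({v}ᶜ : Set V)}
    (hX : (G.deleteVertex v).cutRank X < l) (hl : l ≤ G.cutRank (Subtype.val '' X)) :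
    G.cutRank (insert v (Subtype.val '' X)) ≤ l ∧
      ∃ x ∈ G.lagrangian, x ∈ supportedOn (insert v (Subtype.val '' X)) ∧ x v = (0, 1) := by
  classical
  set Y : Set V := Subtype.val '' X
  have hvY : v ∉ Y := by rintro ⟨w, -, hw⟩; exact w.2 hw
  set M : Submodule (ZMod 2) (V → ZMod 2 × ZMod 2) := (G.lagrangian ⊓ supportedOn (insert v Y)) ⊓
    LinearMap.ker (LinearMap.fst (ZMod 2) (ZMod 2) (ZMod 2) ∘ₗ LinearMap.proj v) with hM
  let ext' := Function.ExtendByZero.linearMap (ZMod 2) (Subtype.val : ({v}ᶜ : Set V) → V)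
  have hext : ∀ a (w : ({v}ᶜ : Set V)), ext' a w = a w :=
    fun a w => Subtype.val_injective.extend_apply a 0 w
  have hextv : ∀ a, ext' a v = 0 := by
    intro a
    exact Function.extend_apply' _ _ _ (by rintro ⟨w, hw⟩; exact w.2 hw)
  have hmap : ∀ a (w : ({v}ᶜ : Set V)), G.graphMap (ext' a) w = (G.deleteVertex v).graphMap a w := by
    intro a w
    refine Prod.ext (hext a w) ((sum_subtype_eq (fun u => G.binaryAdj w u) a).trans ?_)
    exact Finset.sum_congr rfl fun u _ => 
      congrArg (· * a u) (G.binaryAdj_deleteVertex v w u).symm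
  let ψ := (G.graphMap ∘ₗ ext' ∘ₗ (LinearMap.fst (ZMod 2) (ZMod 2) (ZMod 2)).compLeft _).domRestrict
    ((G.deleteVertex v).lagrangian ⊓ supportedOn X)
  have hψ : ∀ y (w : ({v}ᶜ : Set V)), ψ y w = y.1 w := by
    rintro ⟨_, ⟨a, rfl⟩, hy⟩ w
    exact hmap a w
  have hinj : Function.Injective ψ := by
    intro y z hyz
    ext1
    funext w
    rw [← hψ, ← hψ, hyz]
  have hrange : LinearMap.range ψ ≤ M := by
    rintro _ ⟨y, rfl⟩
    refine ⟨⟨⟨_, rfl⟩, fun w hw => ?_⟩, hextv _⟩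
    rw [Set.mem_insert_iff, not_or] at hw
    rw [hψ y ⟨w, hw.1⟩]
    exact y.2.2 _ fun hwX => hw.2 ⟨_, hwX, rfl⟩
  have h1 : finrank (ZMod 2) ((G.deleteVertex v).lagrangian ⊓ supportedOn X : Submodule _ _) ≤
      finrank (ZMod 2) M := by
    rw [← LinearMap.finrank_range_of_inj hinj]
    exact Submodule.finrank_mono hrange
  have h2 := (G.deleteVertex v).cutRank_add_finrank X
  have h3 := G.cutRank_add_finrank Y
  have h4 := G.cutRank_add_finrank (insert v Y)
  have h5 : finrank (ZMod 2) M ≤ finrank (ZMod 2)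
    (G.lagrangian ⊓ supportedOn (insert v Y) : Submodule _ _) := Submodule.finrank_mono inf_le_left
  have h6 : Y.ncard = X.ncard := Set.ncard_image_of_injective X Subtype.val_injective
  rw [Set.ncard_insert_of_notMem hvY] at h4
  refine ⟨by omega, ?_⟩
  by_contra! hcon
  have h7 : M ≤ G.lagrangian ⊓ supportedOn Y := by
    rintro x ⟨⟨hxL, hx⟩, hxv⟩
    refine ⟨hxL, fun w hw => ?_⟩
    by_cases hwv : w = v
    · subst hwv
      have h8 := hcon x hxL hx
      have h9 : (x w).1 = 0 := hxv
      revert h8 h9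
      generalize x w = p
      revert p; decide
    · exact hx w (by simp [hwv, hw])
  have h8 := Submodule.finrank_mono h7
  omega

theorem isCritical_of_cutConnectivityDelete_ne (G : SimpleGraph V) {k : ℕ} {Q R : Set V}
    (hQR : Disjoint Q R) (hk : G.cutConnectivity Q R = k) {v : V} (hvQ : v ∉ Q) (hvR : v ∉ R)
    (hv : G.cutConnectivityDelete v Q R ≠ k) :
    IsCritical G.lagrangian G.cutRank k Q R v (0, 1) := by
  classical
  have hlt : G.cutConnectivityDelete v Q R < k := by
    refine lt_of_le_of_ne ?_ hv
    obtain ⟨X, hX, hX', hXk⟩ := G.exists_cutRank_eq hQR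
    rw [← hk, ← hXk]
    exact (le_cutRank (G := G.deleteVertex v) rfl (Subtype.val ⁻¹' X) (Set.preimage_mono hX)
      (Set.preimage_mono hX')).trans (G.cutRank_deleteVertex_le v X)
  obtain ⟨X, hQX, hXR, hX⟩ := (G.deleteVertex v).exists_cutRank_eq
    (hQR.preimage (Subtype.val : ({v}ᶜ : Set V) → V))
  have hXk : (G.deleteVertex v).cutRank X < k := by
    rw [hX]; exact hlt
  set Y : Set V := Subtype.val '' X with hY
  have hvY : v ∉ Y := by rintro ⟨w, -, hw⟩; exact w.2 hw
  have hQY : Q ⊆ Y := fun w hw =>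
    ⟨⟨w, fun h => hvQ (h ▸ hw)⟩, hQX (by exact hw), rfl⟩
  have hYR : Y ⊆ Rᶜ := by
    rintro _ ⟨w, hw, rfl⟩
    exact hXR hw
  have hQY' := hQY.trans (Set.subset_insert v Y)
  have hYR' : insert v Y ⊆ Rᶜ := Set.insert_subset hvR hYR
  have hk1 := le_cutRank hk Y hQY hYR
  have hk2 := le_cutRank hk _ hQY' hYR'
  obtain ⟨h1, x, hxL, hx, hxv⟩ := G.exists_mem_of_cutRank_deleteVertex_lt hXk hk1
  have hcompl : (Subtype.val '' Xᶜ : Set V) = (insert v Y)ᶜ := by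
    ext w
    simp only [hY, Set.mem_image, Set.mem_compl_iff, Set.mem_insert_iff, not_or]
    constructor
    · rintro ⟨w, hw, rfl⟩
      refine ⟨w.2, ?_⟩
      rintro ⟨w', hw', hww⟩
      exact hw (Subtype.val_injective hww ▸ hw')
    · rintro ⟨hwv, hw⟩
      exact ⟨⟨w, hwv⟩, fun h => hw ⟨_, h, rfl⟩, rfl⟩
  have hcompl' : insert v (Subtype.val '' Xᶜ : Set V) = Yᶜ := by
    rw [hcompl]
    ext w
    simp only [Set.mem_compl_iff, Set.mem_insert_iff, not_or]
    constructor
    · rintro (rfl | h)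
      · exact hvY
      · exact h.2
    · intro h
      by_cases hw : w = v
      · exact .inl hw
      · exact .inr ⟨hw, h⟩
  -- The same count on the other side of the cut gives the second witness and the bound on `ρ Y`.
  obtain ⟨h2, z, hzL, hz, hzv⟩ := G.exists_mem_of_cutRank_deleteVertex_lt (X := Xᶜ) (l := k)
    (by rwa [cutRank_compl]) (by rwa [hcompl, cutRank_compl])
  rw [hcompl'] at hz h2
  rw [cutRank_compl] at h2
  exact ⟨Y, hvY, ⟨hQY, hYR, le_antisymm h2 hk1⟩, ⟨hQY', hYR', le_antisymm h1 hk2⟩,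
    ⟨x, hxL, hx, hxv⟩, z, hzL, hz, hzv⟩

theorem isCritical_of_pivot_ne (G : SimpleGraph V) {k : ℕ} {Q R : Set V}
    (hQR : Disjoint Q R) (hk : G.cutConnectivity Q R = k) {u v : V} (huv : G.Adj u v)
    (hvQ : v ∉ Q) (hvR : v ∉ R) (hv : (G.pivot u v).cutConnectivityDelete v Q R ≠ k) :
    IsCritical G.lagrangian G.cutRank k Q R v (1, 0) := by
  obtain ⟨Φ, hΦ, hΦv⟩ := G.exists_isLocalEquiv_pivot huv
  refine hΦ.isCritical hΦv (isCritical_of_cutConnectivityDelete_ne _ hQR ?_ hvQ hvR hv)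
  simp only [cutConnectivity, hΦ.cutRank_eq] at hk ⊢
  exact hk

end SimpleGraph

/-! ### Assembly of the theorem. -/

open IsotropicSystem SimpleGraph in
theorem corollary1p3 {V : Type*} [Fintype V] (G : SimpleGraph V) (Q R S T : Set V)
    (hQR : Disjoint Q R) (hST : Disjoint S T) (k l : ℕ)
    (hk : G.cutConnectivity Q R = k) (hl : G.cutConnectivity S T = l)
    (hF : (2 * l + 1) * 2 ^ (2 * k) ≤ ((Q ∪ R ∪ S ∪ T)ᶜ : Set V).ncard) :
    ∃ v ∈ ((Q ∪ R ∪ S ∪ T)ᶜ : Set V),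
      (G.cutConnectivityDelete v Q R = k ∧ G.cutConnectivityDelete v S T = l) ∨
      (∀ u : V, G.Adj v u →
        (G.pivot u v).cutConnectivityDelete v Q R = k ∧
        (G.pivot u v).cutConnectivityDelete v S T = l) := by
  by_contra! hcon
  have hmin := le_cutRank hk
  have hmin' := le_cutRank hl
  have key : ∀ v ∈ (Q ∪ R ∪ S ∪ T)ᶜ, ∃ α β : ZMod 2 × ZMod 2, α ≠ 0 ∧ β ≠ 0 ∧ α ≠ β ∧
      IsCritical G.lagrangian G.cutRank k Q R v α ∧
      IsCritical G.lagrangian G.cutRank l S T v β := by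
    intro v hv
    obtain ⟨hdel, u, hvu, hpiv⟩ := hcon v hv
    simp only [Set.mem_compl_iff, Set.mem_union, not_or] at hv
    obtain ⟨⟨⟨hvQ, hvR⟩, hvS⟩, hvT⟩ := hv
    have d1 := G.isCritical_of_cutConnectivityDelete_ne hQR hk hvQ hvR
    have d2 := G.isCritical_of_cutConnectivityDelete_ne hST hl hvS hvT
    have p1 := G.isCritical_of_pivot_ne hQR hk hvu.symm hvQ hvR
    have p2 := G.isCritical_of_pivot_ne hST hl hvu.symm hvS hvT
    have n1 : ((0, 1) : ZMod 2 × ZMod 2) ≠ 0 := by decide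
    have n2 : ((1, 0) : ZMod 2 × ZMod 2) ≠ 0 := by decide
    have n3 : ((0, 1) : ZMod 2 × ZMod 2) ≠ (1, 0) := by decide
    -- Deletion and pivoting each fail for some pair; uniqueness of the critical direction forces
    -- them to fail for different pairs.
    by_cases hd : G.cutConnectivityDelete v Q R = k
    · have hd2 := d2 (hdel hd)
      by_cases hp : (G.pivot u v).cutConnectivityDelete v Q R = k
      · exact absurd (G.isCutSystem.isCritical_unique hmin' n1 n2 hd2 (p2 (hpiv hp))) n3
      · exact ⟨_, _, n2, n1, n3.symm, p1 hp, hd2⟩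
    · have hd1 := d1 hd
      by_cases hp : (G.pivot u v).cutConnectivityDelete v Q R = k
      · exact ⟨_, _, n1, n2, n3, hd1, p2 (hpiv hp)⟩
      · exact absurd (G.isCutSystem.isCritical_unique hmin n1 n2 hd1 (p1 hp)) n3
  choose! α β hα hβ hαβ hcα hcβ using key
  exact absurd (G.isCutSystem.ncard_lt_of_isCritical hmin hmin' α β hcα hcβ hα hβ hαβ)
    (not_lt.2 hF)
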